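/- Consider the problem of maximizing $f(S)$ subject to $c(S)=\sum_{e\in S}c(e)\le K$, $S\subseteq E$, where $E$ is a finite set of $n$ items, $f:2^E\to\mathbb{R}_{\ge 0}$ is monotone and submodular and given by a value oracle, $K$ is a positive integer, and $c:E\to\{1,\dots,K\}$. There are a multi-pass streaming algorithm (a fixed program of a random access machine with unit-cost arithmetic and unit-cost oracle calls on sets of items held in memory, possibly together with the current item, which receives $K$ and $\varepsilon$ as input and reads the items in an arbitrary order, the same in each pass) and an absolute constant $C$ such that the following holds for every $\varepsilon\in(0,1)$ and every instance $(f,c,K,E)$. If some optimal solution $\mathrm{OPT}$ is non-empty and its largest item $o_1$ satisfies $c(o_1)/K\ge 1/2$, then the algorithm halts with a feasible set $S$ such that $$f(S)\ \ge\ \left(\tfrac12-\varepsilon\right) f(\mathrm{OPT}),$$ and it uses at most $C\varepsilon^{-1}$ passes, at most $C\,K\varepsilon^{-5}\log^2(K+1)$ memory cells and stored items, and at most $C\,n\,\varepsilon^{-6}\log^2(K+1)$ time steps. -/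

import Mathlib

/-- An instance `(f, c, K, E)` of monotone submodular maximization under a knapsack constraint on
the finite ground set `E`: maximize `f S` subject to `c(S) ≤ K`. -/
structure KnapsackInstance (E : Type*) [DecidableEq E] where
  /-- the objective function -/
  f : Finset E → ℝ
  /-- the size function -/
  c : E → ℕ
  /-- the capacity of the knapsack -/
  K : ℕ
  f_nonneg : ∀ S, 0 ≤ f S
  f_monotone : ∀ S T, S ⊆ T → f S ≤ f T
  f_submodular : ∀ S T e, S ⊆ T → e ∉ T → f (insert e T) - f T ≤ f (insert e S) - f S
  c_pos : ∀ e, 0 < c e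
  K_pos : 0 < K
  c_le : ∀ e, c e ≤ K

namespace KnapsackInstance

variable {E : Type*} [DecidableEq E]

/-- `c(S) ≤ K`, where `c(S)` is the total size of the items of `S`. -/
def Feasible (I : KnapsackInstance E) (S : Finset E) : Prop :=
  ∑ e ∈ S, I.c e ≤ I.K

/-- `S` is an optimal solution. -/
def IsOptimal (I : KnapsackInstance E) (S : Finset E) : Prop :=
  I.Feasible S ∧ ∀ T, I.Feasible T → I.f T ≤ I.f S

end KnapsackInstance

/-! A random access machine for multi-pass streaming algorithms with a value oracle for `f`.

The memory has integer cells, real cells, and set cells (each holding a set of stored items), all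
indirectly addressable. Items are opaque: a program can see the size of the item that is currently
under the reading head of the stream, can add this item to a set cell, and can ask the oracle for
the value of `f` on a set cell (with or without the current item). Programs are finite and mention
neither the ground set nor the input; arithmetic has unit cost, as usual for real RAMs. There is no
rounding of reals to integers. -/
namespace StreamRAM

/-- Integer expressions. -/
inductive NExp : Type
  | const (k : ℕ)
  /-- content of the integer cell with the given address -/
  | cell (a : NExp)
  /-- size of the current item of the stream (`0` if the stream is exhausted) -/
  | curSize
  | add (a b : NExp)
  /-- truncated subtraction -/
  | sub (a b : NExp)
  | mul (a b : NExp)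

/-- Real expressions. -/
inductive RExp : Type
  | const (q : ℚ)
  /-- content of the real cell with the given address -/
  | cell (a : NExp)
  | ofNat (a : NExp)
  | add (a b : RExp)
  | sub (a b : RExp)
  | mul (a b : RExp)
  /-- division; the result of a division by zero is `0` -/
  | div (a b : RExp)

/-- Conditions for branching. -/
inductive Test : Type
  | natLt (a b : NExp)
  | realLt (a b : RExp)
  /-- the current pass over the stream is finished -/
  | atEnd
  | not (t : Test)
  | and (t u : Test)

/-- Elementary instructions. -/
inductive Instr : Type
  /-- integer cell `a` := `v` -/
  | setNat (a v : NExp)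
  /-- real cell `a` := `v` -/
  | setReal (a : NExp) (v : RExp)
  /-- real cell `d` := `f (S)`, with `S` the content of set cell `a` -/
  | query (d a : NExp)
  /-- real cell `d` := `f (S + e)`, with `S` the content of set cell `a` and `e` the current item -/
  | queryCur (d a : NExp)
  /-- set cell `a` := `∅` -/
  | clear (a : NExp)
  /-- add the current item to set cell `a` -/
  | insertCur (a : NExp)
  /-- add all items of set cell `b` to set cell `a` -/
  | union (a b : NExp)
  /-- move on to the next item of the stream -/
  | advance
  /-- start a new pass over the stream -/
  | beginPass

/-- Programs. -/
inductive Program : Type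
  | instr (i : Instr)
  | seq (P Q : Program)
  | ite (t : Test) (P Q : Program)
  | whileDo (t : Test) (P : Program)

/-- Memory content, together with the part of the stream that the current pass has still to read.
The current item is the head of `rest`. -/
structure State (E : Type*) where
  nats : ℕ → ℕ
  reals : ℕ → ℝ
  sets : ℕ → Finset E
  rest : List E

variable {E : Type*} [DecidableEq E]

/-- At the start integer cell `0` holds `K`, real cell `0` holds `ε`, the rest of the memory is
blank, and no pass has been started. -/
noncomputable def State.init (K : ℕ) (ε : ℝ) : State E where
  nats := Function.update (fun _ => 0) 0 K
  reals := Function.update (fun _ => 0) 0 ε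
  sets := fun _ => ∅
  rest := []

/-- The current item as a set with at most one element. -/
def State.cur (σ : State E) : Finset E := σ.rest.head?.toFinset

/-- The content `σ` of the memory takes up at most `s` units of space: only the first `s` cells of
each kind are in use, the set cells hold at most `s` items in total (an item is counted once for
each set cell that contains it), and no integer cell holds an integer above `s` (thus integers are
addresses or comparable quantities). -/
def State.Fits (s : ℕ) (σ : State E) : Prop :=
  (∀ i, s ≤ i → σ.nats i = 0 ∧ σ.reals i = 0 ∧ σ.sets i = ∅) ∧
  (∑ i ∈ Finset.range s, (σ.sets i).card ≤ s) ∧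
  (∀ i, σ.nats i ≤ s)

/-- Write `v` into integer cell `a`. -/
def State.setNatCell (σ : State E) (a v : ℕ) : State E :=
  { σ with nats := Function.update σ.nats a v }

/-- Write `v` into real cell `a`. -/
noncomputable def State.setRealCell (σ : State E) (a : ℕ) (v : ℝ) : State E :=
  { σ with reals := Function.update σ.reals a v }

/-- Write `S` into set cell `a`. -/
def State.setSetCell (σ : State E) (a : ℕ) (S : Finset E) : State E :=
  { σ with sets := Function.update σ.sets a S }

/-- Value of an integer expression, for the size function `c`. -/
def NExp.eval (c : E → ℕ) (σ : State E) : NExp → ℕ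
  | .const k => k
  | .cell a => σ.nats (a.eval c σ)
  | .curSize => ∑ e ∈ σ.cur, c e
  | .add a b => a.eval c σ + b.eval c σ
  | .sub a b => a.eval c σ - b.eval c σ
  | .mul a b => a.eval c σ * b.eval c σ

/-- Value of a real expression. -/
noncomputable def RExp.eval (c : E → ℕ) (σ : State E) : RExp → ℝ
  | .const q => (q : ℝ)
  | .cell a => σ.reals (a.eval c σ)
  | .ofNat a => (a.eval c σ : ℝ)
  | .add a b => a.eval c σ + b.eval c σ
  | .sub a b => a.eval c σ - b.eval c σ
  | .mul a b => a.eval c σ * b.eval c σ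
  | .div a b => a.eval c σ / b.eval c σ

/-- Truth of a condition. -/
def Test.Holds (c : E → ℕ) (σ : State E) : Test → Prop
  | .natLt a b => a.eval c σ < b.eval c σ
  | .realLt a b => a.eval c σ < b.eval c σ
  | .atEnd => σ.rest = []
  | .not t => ¬ t.Holds c σ
  | .and t u => t.Holds c σ ∧ u.Holds c σ

/-- Effect of an elementary instruction on the state. -/
noncomputable def Instr.step (I : KnapsackInstance E) (stream : List E) (σ : State E) :
    Instr → State E
  | .setNat a v => σ.setNatCell (a.eval I.c σ) (v.eval I.c σ)
  | .setReal a v => σ.setRealCell (a.eval I.c σ) (v.eval I.c σ)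
  | .query d a => σ.setRealCell (d.eval I.c σ) (I.f (σ.sets (a.eval I.c σ)))
  | .queryCur d a => σ.setRealCell (d.eval I.c σ) (I.f (σ.sets (a.eval I.c σ) ∪ σ.cur))
  | .clear a => σ.setSetCell (a.eval I.c σ) ∅
  | .insertCur a => σ.setSetCell (a.eval I.c σ) (σ.sets (a.eval I.c σ) ∪ σ.cur)
  | .union a b => σ.setSetCell (a.eval I.c σ) (σ.sets (a.eval I.c σ) ∪ σ.sets (b.eval I.c σ))
  | .advance => { σ with rest := σ.rest.tail }
  | .beginPass => { σ with rest := stream }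

/-- Time taken by an elementary instruction: one step, in particular for a call of the oracle, but
copying a stored set takes one more step for each of its items. -/
def Instr.time (c : E → ℕ) (σ : State E) : Instr → ℕ
  | .union _ b => 1 + (σ.sets (b.eval c σ)).card
  | _ => 1

/-- Number of passes started by an elementary instruction. -/
def Instr.passes : Instr → ℕ
  | .beginPass => 1
  | _ => 0

/-- `Exec I stream s P σ σ' t p`: on the instance `I`, whose items arrive in the order `stream`,
the program `P` started in the state `σ` halts in the state `σ'` after `t` steps and `p` passes
over the stream, and its memory never takes up more than `s` units of space. Each evaluation of a
condition counts as a step. -/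
inductive Exec (I : KnapsackInstance E) (stream : List E) (s : ℕ) :
    Program → State E → State E → ℕ → ℕ → Prop
  | instr (i : Instr) (σ : State E) :
      σ.Fits s → (i.step I stream σ).Fits s →
      Exec I stream s (.instr i) σ (i.step I stream σ) (i.time I.c σ) i.passes
  | seq (P Q : Program) (σ σ' σ'' : State E) (t t' p p' : ℕ) :
      Exec I stream s P σ σ' t p → Exec I stream s Q σ' σ'' t' p' →
      Exec I stream s (.seq P Q) σ σ'' (t + t') (p + p')
  | iteTrue (b : Test) (P Q : Program) (σ σ' : State E) (t p : ℕ) :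
      b.Holds I.c σ → Exec I stream s P σ σ' t p →
      Exec I stream s (.ite b P Q) σ σ' (t + 1) p
  | iteFalse (b : Test) (P Q : Program) (σ σ' : State E) (t p : ℕ) :
      ¬ b.Holds I.c σ → Exec I stream s Q σ σ' t p →
      Exec I stream s (.ite b P Q) σ σ' (t + 1) p
  | whileTrue (b : Test) (P : Program) (σ σ' σ'' : State E) (t t' p p' : ℕ) :
      b.Holds I.c σ → Exec I stream s P σ σ' t p →
      Exec I stream s (.whileDo b P) σ' σ'' t' p' →
      Exec I stream s (.whileDo b P) σ σ'' (t + 1 + t') (p + p')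
  | whileFalse (b : Test) (P : Program) (σ : State E) :
      ¬ b.Holds I.c σ → Exec I stream s (.whileDo b P) σ σ 1 0

end StreamRAM

/-!
Let `o` be the largest item of the optimal solution `O`, with `c(o) ≥ K / 2`, let `W = K - c(o)`, and
let `R` be the set of the other items of `O`, so that `c(R) ≤ W ≤ K / 2`. Suppose first that
`f(O)` and `W > 0` are known. Run the single-pass threshold algorithm that adds an item to `S` if it
fits into the knapsack, if its marginal density is at least `f(O) / (2 W)`, and if `c(S) < W`
before. If `c(S)` reaches `W`, then `f(S) ≥ W · f(O) / (2 W) = f(O) / 2`. Otherwise `o` still fits,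
and every item of `R` has been selected or has low marginal density with respect to `S` (it was
never rejected for its size, since `c(S) + c(R) ≤ 2 W ≤ K`). By submodularity
`f(O) ≤ f(S + o) + c(R) · f(O) / (2 W) ≤ f(S + o) + f(O) / 2`. So one of `S` and `S + o` is good
enough, and the best set of the form `S` or `S + e` is found in one more pass. The case `W = 0` is
covered by the threshold `1` for `c(S)`, which forces `S = ∅` unless it is reached. This is
`KnapsackInstance.greedy_guarantee`, in a form that tolerates errors of a factor `1 + ε` in both
guesses.

The guesses are taken from geometric grids with ratio `1 + ε`: `f(O)` lies between the largest value
`m` of a single item, found in a preliminary pass, and `K * m`. There are `N = O(log (K + 1) / ε)`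
grid points for each of the two guesses (`KnapsackInstance.exists_grid_size`), and all `N * N` pairs
are treated in parallel (`StreamRAM.exists_guess`). Three passes, `O(N * N * K)` units of space and
`O(n * N * N)` steps suffice (`StreamRAM.runs_knapsackProgram`).

The program is verified with time bounds by rules for its constructs (`StreamRAM.Runs`), and the
states between its parts are described by the predicate `StreamRAM.Layout`.
-/

/-! ### Submodular functions -/

namespace KnapsackInstance

variable {E : Type*} [DecidableEq E] (I : KnapsackInstance E)

/-- Diminishing returns without the requirement that the new item is new. -/
lemma marginal_anti {S T : Finset E} (h : S ⊆ T) (e : E) :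
    I.f (T ∪ {e}) - I.f T ≤ I.f (S ∪ {e}) - I.f S := by
  by_cases he : e ∈ T
  · rw [Finset.union_eq_left.2 (Finset.singleton_subset_iff.2 he), sub_self]
    exact sub_nonneg.2 (I.f_monotone _ _ Finset.subset_union_left)
  · simpa [Finset.union_singleton] using I.f_submodular S T e h he

lemma f_union_le (S R : Finset E) :
    I.f (S ∪ R) ≤ I.f S + ∑ e ∈ R, (I.f (S ∪ {e}) - I.f S) := by
  induction R using Finset.induction_on with
  | empty => simp
  | insert a R ha ih =>
    have h := I.marginal_anti (Finset.subset_union_left : S ⊆ S ∪ R) a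
    have e : S ∪ insert a R = S ∪ R ∪ {a} := by
      rw [Finset.insert_eq, Finset.union_comm {a}, Finset.union_assoc]
    rw [Finset.sum_insert ha, e]
    linarith

lemma card_le_of_feasible {S : Finset E} (h : I.Feasible S) : S.card ≤ I.K := by
  refine le_trans ?_ h
  rw [Finset.card_eq_sum_ones]
  exact Finset.sum_le_sum fun e _ => I.c_pos e

lemma feasible_singleton (e : E) : I.Feasible {e} := by
  simpa [Feasible] using I.c_le e

lemma f_le_card_mul {S : Finset E} (hS : S.Nonempty) {m : ℝ} (hm : ∀ e, I.f {e} ≤ m) :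
    I.f S ≤ S.card * m := by
  obtain ⟨a, ha⟩ := hS
  have h := I.f_union_le {a} (S.erase a)
  have hsum : ∑ e ∈ S.erase a, (I.f ({a} ∪ {e}) - I.f {a}) ≤ ∑ e ∈ S.erase a, m := by
    refine Finset.sum_le_sum fun e _ => ?_
    have h1 := I.marginal_anti (Finset.empty_subset {a}) e
    rw [Finset.empty_union] at h1
    have h2 := I.f_nonneg ∅
    linarith [hm e]
  rw [← Finset.insert_eq, Finset.insert_erase ha] at h
  rw [Finset.sum_const, nsmul_eq_mul] at hsum
  have hc : (S.card : ℝ) = (S.erase a).card + 1 := by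
    exact_mod_cast (Finset.card_erase_add_one ha).symm
  rw [hc]
  linarith [hm a]

/-! ### The threshold greedy algorithm -/

/-- Whether the threshold algorithm adds the item `e` to `S`: the total size of `S` has not reached
`w` yet, the item fits into the knapsack, and its marginal density is at least `p / (2 * w)`. -/
def Accepts (p w : ℝ) (S : Finset E) (e : E) : Prop :=
  ((∑ x ∈ S, I.c x : ℕ) : ℝ) < w ∧ ∑ x ∈ S, I.c x + I.c e ≤ I.K ∧
    p * I.c e ≤ 2 * w * (I.f (S ∪ {e}) - I.f S)

open Classical in
/-- One step of the threshold algorithm. -/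
noncomputable def grow (p w : ℝ) (S : Finset E) (e : E) : Finset E :=
  if I.Accepts p w S e then S ∪ {e} else S

/-- The set that the threshold algorithm selects from the items of a list. -/
noncomputable def greedy (p w : ℝ) (l : List E) : Finset E :=
  l.foldl (I.grow p w) ∅

variable {I} {p w : ℝ}

lemma grow_of_accepts {S : Finset E} {e : E} (h : I.Accepts p w S e) :
    I.grow p w S e = S ∪ {e} := if_pos h

lemma grow_of_not_accepts {S : Finset E} {e : E} (h : ¬ I.Accepts p w S e) :
    I.grow p w S e = S := if_neg h

@[simp] lemma greedy_nil : I.greedy p w [] = ∅ := rfl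

lemma greedy_concat (l : List E) (e : E) :
    I.greedy p w (l ++ [e]) = I.grow p w (I.greedy p w l) e := by
  simp [greedy]

lemma subset_grow (S : Finset E) (e : E) : S ⊆ I.grow p w S e := by
  by_cases h : I.Accepts p w S e
  · rw [grow_of_accepts h]; exact Finset.subset_union_left
  · rw [grow_of_not_accepts h]

lemma greedy_subset_append (l l' : List E) : I.greedy p w l ⊆ I.greedy p w (l ++ l') := by
  induction l' using List.reverseRecOn with
  | nil => simp
  | append_singleton l' e ih =>
    rw [← List.append_assoc, greedy_concat]
    exact ih.trans (subset_grow _ _)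

lemma mem_of_mem_greedy {l : List E} {x : E} (hx : x ∈ I.greedy p w l) : x ∈ l := by
  induction l using List.reverseRecOn with
  | nil => simp at hx
  | append_singleton l e ih =>
    rw [greedy_concat] at hx
    by_cases h : I.Accepts p w (I.greedy p w l) e
    · rw [grow_of_accepts h] at hx
      simp only [Finset.mem_union, Finset.mem_singleton] at hx
      rcases hx with hx | hx
      · exact List.mem_append_left _ (ih hx)
      · simp [hx]
    · rw [grow_of_not_accepts h] at hx
      exact List.mem_append_left _ (ih hx)

lemma sum_union_singleton {S : Finset E} {e : E} (he : e ∉ S) :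
    ∑ x ∈ S ∪ {e}, I.c x = ∑ x ∈ S, I.c x + I.c e := by
  rw [Finset.sum_union (by simpa using he), Finset.sum_singleton]

lemma feasible_greedy {l : List E} (hl : l.Nodup) : I.Feasible (I.greedy p w l) := by
  induction l using List.reverseRecOn with
  | nil => simp [Feasible]
  | append_singleton l e ih =>
    rw [List.nodup_append] at hl
    have he : e ∉ I.greedy p w l := fun h => hl.2.2 _ (mem_of_mem_greedy h) e (by simp) rfl
    rw [greedy_concat]
    by_cases h : I.Accepts p w (I.greedy p w l) e
    · rw [grow_of_accepts h, Feasible, sum_union_singleton he]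
      exact h.2.1
    · rw [grow_of_not_accepts h]
      exact ih hl.1

/-- The selected set has density at least `p / (2 * w)`, as each of its items has had this density
on arrival. -/
lemma mul_size_greedy_le {l : List E} (hl : l.Nodup) (hw : 0 ≤ w) :
    p * ((∑ x ∈ I.greedy p w l, I.c x : ℕ) : ℝ) ≤ 2 * w * I.f (I.greedy p w l) := by
  induction l using List.reverseRecOn with
  | nil => simpa using mul_nonneg (mul_nonneg two_pos.le hw) (I.f_nonneg ∅)
  | append_singleton l e ih =>
    rw [List.nodup_append] at hl
    have he : e ∉ I.greedy p w l := fun h => hl.2.2 _ (mem_of_mem_greedy h) e (by simp) rfl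
    have ih := ih hl.1
    rw [greedy_concat]
    by_cases h : I.Accepts p w (I.greedy p w l) e
    · rw [grow_of_accepts h, sum_union_singleton he]
      have h3 := h.2.2
      rw [Nat.cast_add]
      linarith
    · rwa [grow_of_not_accepts h]

/-- As long as the selected set is small, an item that still fits has low marginal density: it was
either selected, or rejected for its density with respect to a smaller set. -/
lemma marginal_greedy_le {l : List E} {r : E} (hr : r ∈ l) (hp : 0 ≤ p) (hw : 0 ≤ w)
    (hlt : ((∑ x ∈ I.greedy p w l, I.c x : ℕ) : ℝ) < w)
    (hfit : ∑ x ∈ I.greedy p w l, I.c x + I.c r ≤ I.K) :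
    2 * w * (I.f (I.greedy p w l ∪ {r}) - I.f (I.greedy p w l)) ≤ p * I.c r := by
  obtain ⟨l₁, l₂, rfl⟩ := List.append_of_mem hr
  have hsub : I.greedy p w (l₁ ++ [r]) ⊆ I.greedy p w (l₁ ++ r :: l₂) := by
    simpa using greedy_subset_append (I := I) (p := p) (w := w) (l₁ ++ [r]) l₂
  have hsub' : I.greedy p w l₁ ⊆ I.greedy p w (l₁ ++ r :: l₂) := greedy_subset_append _ _
  have hle : ∑ x ∈ I.greedy p w l₁, I.c x ≤ ∑ x ∈ I.greedy p w (l₁ ++ r :: l₂), I.c x :=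
    Finset.sum_le_sum_of_subset hsub'
  by_cases h : I.Accepts p w (I.greedy p w l₁) r
  · rw [greedy_concat, grow_of_accepts h] at hsub
    have hmem : r ∈ I.greedy p w (l₁ ++ r :: l₂) := hsub (by simp)
    rw [Finset.union_eq_left.2 (Finset.singleton_subset_iff.2 hmem), sub_self, mul_zero]
    positivity
  · have h1 : 2 * w * (I.f (I.greedy p w l₁ ∪ {r}) - I.f (I.greedy p w l₁)) < p * I.c r := by
      by_contra hcon
      exact h ⟨lt_of_le_of_lt (by exact_mod_cast hle) hlt, by omega, not_lt.1 hcon⟩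
    have h2 := I.marginal_anti hsub' r
    exact (mul_le_mul_of_nonneg_left h2 (by positivity)).trans h1.le

/-- The approximation guarantee for the guess `p` of the optimal value and the guess `w` of the
capacity left by the largest item. If the greedy set reaches the size `w`, its density makes it
valuable enough; otherwise `o₁` still fits, and the other items of the optimal solution have low
marginal density. -/
lemma greedy_guarantee {ε : ℝ} (hε : 0 < ε) {l : List E} (hl : l.Nodup) (hmem : ∀ e, e ∈ l)
    {O : Finset E} (hO : I.Feasible O) {o : E} (ho : o ∈ O) (hbig : I.K ≤ 2 * I.c o)
    (hp : 0 ≤ p) (hw : 0 < w) (hp1 : p ≤ I.f O) (hp2 : I.f O ≤ (1 + ε) * p)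
    (hw1 : w ≤ max 1 ((I.K - I.c o : ℕ) : ℝ)) (hw2 : ((I.K - I.c o : ℕ) : ℝ) ≤ (1 + ε) * w) :
    (1 / 2 - ε) * I.f O ≤ I.f (I.greedy p w l) ∨
      (∑ x ∈ I.greedy p w l, I.c x + I.c o ≤ I.K ∧
        (1 / 2 - ε) * I.f O ≤ I.f (I.greedy p w l ∪ {o})) := by
  have hO0 := I.f_nonneg O
  have hcK := I.c_le o
  rcases le_or_gt w ((∑ x ∈ I.greedy p w l, I.c x : ℕ) : ℝ) with hge | hlt
  · left
    have h1 := mul_size_greedy_le (I := I) (p := p) hl hw.le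
    have h2 : p * w ≤ 2 * w * I.f (I.greedy p w l) :=
      (mul_le_mul_of_nonneg_left hge hp).trans h1
    have h3 : p ≤ 2 * I.f (I.greedy p w l) := by
      refine le_of_mul_le_mul_right ?_ hw
      linarith
    nlinarith
  · right
    set S := I.greedy p w l with hS
    have hsize : ∑ x ∈ S, I.c x ≤ I.K - I.c o := by
      rcases max_choice (1 : ℝ) ((I.K - I.c o : ℕ) : ℝ) with hmax | hmax
      · -- a total size below `1` vanishes, which settles the case of no remaining capacity
        rw [hmax] at hw1
        have : ∑ x ∈ S, I.c x < 1 := by exact_mod_cast hlt.trans_le hw1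
        omega
      · rw [hmax] at hw1
        exact_mod_cast (hlt.trans_le hw1).le
    refine ⟨by omega, ?_⟩
    have hR : ∑ x ∈ O.erase o, I.c x ≤ I.K - I.c o := by
      have := Finset.add_sum_erase O I.c ho
      have hO' : ∑ x ∈ O, I.c x ≤ I.K := hO
      omega
    have hsum : 2 * w * ∑ e ∈ O.erase o, (I.f (S ∪ {o} ∪ {e}) - I.f (S ∪ {o})) ≤
        p * ((∑ e ∈ O.erase o, I.c e : ℕ) : ℝ) := by
      rw [Finset.mul_sum, Nat.cast_sum, Finset.mul_sum]
      refine Finset.sum_le_sum fun e he => ?_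
      have he' : I.c e ≤ I.K - I.c o := (Finset.single_le_sum (fun _ _ => Nat.zero_le _) he).trans hR
      have hfit : ∑ x ∈ S, I.c x + I.c e ≤ I.K := by omega
      have h1 := marginal_greedy_le (I := I) (p := p) (hmem e) hp hw.le hlt hfit
      have h2 := I.marginal_anti (Finset.subset_union_left : S ⊆ S ∪ {o}) e
      exact (mul_le_mul_of_nonneg_left h2 (by positivity)).trans h1
    have hU := I.f_union_le (S ∪ {o}) (O.erase o)
    have hsubset : O ⊆ S ∪ {o} ∪ O.erase o := by
      intro x hx
      by_cases hxo : x = o <;> simp [hx, hxo]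
    have hmono := I.f_monotone _ _ hsubset
    have hR' : ((∑ e ∈ O.erase o, I.c e : ℕ) : ℝ) ≤ (1 + ε) * w :=
      le_trans (by exact_mod_cast hR) hw2
    have h4 := mul_le_mul_of_nonneg_left hR' hp
    have h5 : 2 * ∑ e ∈ O.erase o, (I.f (S ∪ {o} ∪ {e}) - I.f (S ∪ {o})) ≤ p * (1 + ε) := by
      refine le_of_mul_le_mul_right ?_ hw
      linarith
    nlinarith

/-! ### The geometric grid of guesses -/

/-- The grid `r ^ 0, …, r ^ (N - 1)`, which consists of the powers of `r` that are at most `K`,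
approximates the interval `[1, K]` up to the factor `r`. -/
lemma exists_pow_grid {r x : ℝ} {K N : ℕ} (hr : 1 < r) (hN : (K : ℝ) < r ^ N) (h1 : 1 ≤ x)
    (hK : x ≤ K) : ∃ i < N, r ^ i ≤ x ∧ x ≤ r * r ^ i := by
  obtain ⟨i, hi, hi'⟩ := exists_nat_pow_near h1 hr
  refine ⟨i, ?_, hi, by rw [← pow_succ']; exact hi'.le⟩
  exact (pow_lt_pow_iff_right₀ hr).1 (lt_of_le_of_lt (hi.trans hK) hN)

lemma exists_grid_size {ε : ℝ} (hε : 0 < ε) (hε1 : ε < 1) {K : ℕ} (hK : 0 < K) :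
    ∃ N : ℕ, 0 < N ∧ (K : ℝ) < (1 + ε) ^ N ∧ (∀ i < N, (1 + ε) ^ i ≤ (K : ℝ)) ∧
      (N : ℝ) ≤ 4 * (ε⁻¹ * Real.log (K + 1)) := by
  classical
  have hex : ∃ N : ℕ, (K : ℝ) < (1 + ε) ^ N := pow_unbounded_of_one_lt _ (by linarith)
  have hK1 : (1 : ℝ) ≤ K := by exact_mod_cast hK
  have hmin : ∀ i < Nat.find hex, (1 + ε) ^ i ≤ (K : ℝ) := fun i hi => not_lt.1 (Nat.find_min hex hi)
  have hpos : 0 < Nat.find hex := by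
    rw [Nat.find_pos]
    simpa using hK.ne'
  refine ⟨Nat.find hex, hpos, Nat.find_spec hex, hmin, ?_⟩
  obtain ⟨n, hn⟩ := Nat.exists_eq_succ_of_ne_zero hpos.ne'
  have hpow := hmin n (by omega)
  have hlog : n * Real.log (1 + ε) ≤ Real.log (K + 1) := by
    rw [← Real.log_pow]
    exact Real.log_le_log (by positivity) (by linarith)
  have hl1 : ε / 2 ≤ Real.log (1 + ε) := by
    have h := Real.one_sub_inv_le_log_of_pos (by linarith : 0 < 1 + ε)
    have h' : ε / 2 ≤ 1 - (1 + ε)⁻¹ := by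
      rw [div_le_iff₀ two_pos, ← sub_nonneg]
      have : (1 - (1 + ε)⁻¹) * 2 - ε = ε * (1 - ε) / (1 + ε) := by field_simp; ring
      rw [this]
      exact div_nonneg (mul_nonneg hε.le (by linarith)) (by linarith)
    linarith
  have hl2 : 1 / 2 ≤ Real.log (K + 1) := by
    have : Real.log 2 ≤ Real.log (K + 1) := Real.log_le_log two_pos (by linarith)
    linarith [Real.log_two_gt_d9]
  have hn' : (n : ℝ) * ε ≤ 2 * Real.log (K + 1) := by
    have := mul_le_mul_of_nonneg_left hl1 (Nat.cast_nonneg n : (0 : ℝ) ≤ n)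
    linarith
  rw [hn, Nat.cast_succ, ← div_eq_inv_mul, mul_div_assoc', le_div_iff₀ hε]
  linarith

end KnapsackInstance

namespace StreamRAM

/-! ### Memory bounds -/

variable {E : Type*}

/-- Bounds on the memory cells in use when there are `M` guesses: integer cell `0` holds the
capacity, `1` the current guess, `2` the best guess, and `3 + k` the size of the set for guess `k`;
real cells `0`, …, `6` are in use; set cell `0` holds the output, `1` the best additional item, and
`2 + k` the set for guess `k`. -/
structure Bounded (M K : ℕ) (σ : State E) : Prop where
  nats_le : ∀ i, σ.nats i ≤ K + M
  nats_eq : ∀ i, 3 + M ≤ i → σ.nats i = 0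
  reals_eq : ∀ i, 7 ≤ i → σ.reals i = 0
  card_le : ∀ i, (σ.sets i).card ≤ K
  sets_eq : ∀ i, 2 + M ≤ i → σ.sets i = ∅

lemma Bounded.fits {M K : ℕ} {σ : State E} (h : Bounded M K σ) (hM : 0 < M) (hK : 0 < K) :
    σ.Fits (8 * (M * K)) := by
  have h1 : M ≤ M * K := Nat.le_mul_of_pos_right M hK
  have h2 : K ≤ M * K := Nat.le_mul_of_pos_left K hM
  refine ⟨fun i hi => ⟨h.nats_eq i (by omega), h.reals_eq i (by omega), h.sets_eq i (by omega)⟩,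
    ?_, fun i => (h.nats_le i).trans (by omega)⟩
  have hsub : Finset.range (2 + M) ⊆ Finset.range (8 * (M * K)) :=
    Finset.range_subset_range.2 (by omega)
  rw [← Finset.sum_subset hsub fun i _ hi => by
    rw [h.sets_eq i (by simpa using hi), Finset.card_empty]]
  calc ∑ i ∈ Finset.range (2 + M), (σ.sets i).card ≤ ∑ i ∈ Finset.range (2 + M), K :=
        Finset.sum_le_sum fun i _ => h.card_le i
    _ = 2 * K + M * K := by simp [add_mul]
    _ ≤ 8 * (M * K) := by omega

lemma Bounded.setNatCell {M K : ℕ} {σ : State E} (h : Bounded M K σ) {a v : ℕ} (ha : a < 3 + M)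
    (hv : v ≤ K + M) : Bounded M K (σ.setNatCell a v) where
  nats_le i := by
    by_cases hi : i = a
    · simpa [State.setNatCell, hi] using hv
    · simpa [State.setNatCell, hi] using h.nats_le i
  nats_eq i hi := by
    have : i ≠ a := by omega
    simpa [State.setNatCell, this] using h.nats_eq i hi
  reals_eq := h.reals_eq
  card_le := h.card_le
  sets_eq := h.sets_eq

lemma Bounded.setRealCell {M K : ℕ} {σ : State E} (h : Bounded M K σ) {a : ℕ} (ha : a < 7)
    (v : ℝ) : Bounded M K (σ.setRealCell a v) where
  nats_le := h.nats_le
  nats_eq := h.nats_eq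
  reals_eq i hi := by
    have : i ≠ a := by omega
    simpa [State.setRealCell, this] using h.reals_eq i hi
  card_le := h.card_le
  sets_eq := h.sets_eq

lemma Bounded.setSetCell {M K : ℕ} {σ : State E} (h : Bounded M K σ) {a : ℕ} (ha : a < 2 + M)
    {S : Finset E} (hS : S.card ≤ K) : Bounded M K (σ.setSetCell a S) where
  nats_le := h.nats_le
  nats_eq := h.nats_eq
  reals_eq := h.reals_eq
  card_le i := by
    by_cases hi : i = a
    · simpa [State.setSetCell, hi] using hS
    · simpa [State.setSetCell, hi] using h.card_le i
  sets_eq i hi := by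
    have : i ≠ a := by omega
    simpa [State.setSetCell, this] using h.sets_eq i hi

lemma Bounded.setRest {M K : ℕ} {σ : State E} (h : Bounded M K σ) (l : List E) :
    Bounded M K { σ with rest := l } :=
  ⟨h.nats_le, h.nats_eq, h.reals_eq, h.card_le, h.sets_eq⟩

/-! ### Running programs within time bounds -/

variable [DecidableEq E] {I : KnapsackInstance E} {stream : List E} {s : ℕ}

/-- The program `P`, started in `σ`, halts in a state that satisfies `Q` after at most `T` steps and
exactly `p` passes, in `s` units of space. -/
def Runs (I : KnapsackInstance E) (stream : List E) (s : ℕ) (P : Program) (σ : State E) (T p : ℕ)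
    (Q : State E → Prop) : Prop :=
  ∃ σ' t, Exec I stream s P σ σ' t p ∧ t ≤ T ∧ Q σ'

lemma Runs.instr {i : Instr} {σ : State E} {T : ℕ} {Q : State E → Prop} (h : σ.Fits s)
    (h' : (i.step I stream σ).Fits s) (hT : i.time I.c σ ≤ T) (hQ : Q (i.step I stream σ)) :
    Runs I stream s (.instr i) σ T i.passes Q :=
  ⟨_, _, .instr i σ h h', hT, hQ⟩

lemma Runs.seq {P P' : Program} {σ : State E} {T T' T'' p p' : ℕ} {Q R : State E → Prop}
    (h : Runs I stream s P σ T p Q) (h' : ∀ σ', Q σ' → Runs I stream s P' σ' T' p' R)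
    (hT : T + T' ≤ T'') : Runs I stream s (.seq P P') σ T'' (p + p') R := by
  obtain ⟨σ', t, he, ht, hQ⟩ := h
  obtain ⟨σ'', t', he', ht', hR⟩ := h' σ' hQ
  exact ⟨σ'', _, .seq _ _ _ _ _ _ _ _ _ he he', by omega, hR⟩

lemma Runs.ite {b : Test} {P P' : Program} {σ : State E} {T T' p : ℕ} {Q : State E → Prop}
    (h : b.Holds I.c σ → Runs I stream s P σ T p Q)
    (h' : ¬ b.Holds I.c σ → Runs I stream s P' σ T p Q) (hT : T + 1 ≤ T') :
    Runs I stream s (.ite b P P') σ T' p Q := by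
  by_cases hb : b.Holds I.c σ
  · obtain ⟨σ', t, he, ht, hQ⟩ := h hb
    exact ⟨σ', _, .iteTrue _ _ _ _ _ _ _ hb he, by omega, hQ⟩
  · obtain ⟨σ', t, he, ht, hQ⟩ := h' hb
    exact ⟨σ', _, .iteFalse _ _ _ _ _ _ _ hb he, by omega, hQ⟩

lemma Runs.seq_zero {P P' : Program} {σ : State E} {T T' T'' : ℕ} {Q R : State E → Prop}
    (h : Runs I stream s P σ T 0 Q) (h' : ∀ σ', Q σ' → Runs I stream s P' σ' T' 0 R)
    (hT : T + T' ≤ T'') : Runs I stream s (.seq P P') σ T'' 0 R :=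
  Runs.seq h h' hT

/-- An instruction of unit cost that starts no pass, with the new state in a convenient form. -/
lemma Runs.step {i : Instr} {σ σ' : State E} (hσ' : i.step I stream σ = σ') (h : σ.Fits s)
    (h' : σ'.Fits s) (hT : i.time I.c σ ≤ 1) (hp : i.passes = 0) :
    Runs I stream s (.instr i) σ 1 0 (· = σ') := by
  have := Runs.instr (Q := (· = σ')) h (hσ' ▸ h') hT hσ'
  rwa [hp] at this

lemma Runs.mono {P : Program} {σ : State E} {T T' p : ℕ} {Q R : State E → Prop}
    (h : Runs I stream s P σ T p Q) (hT : T ≤ T') (hR : ∀ σ', Q σ' → R σ') :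
    Runs I stream s P σ T' p R := by
  obtain ⟨σ', t, he, ht, hQ⟩ := h
  exact ⟨σ', t, he, ht.trans hT, hR _ hQ⟩

/-- A loop that is left after exactly `n` rounds. -/
lemma Runs.whileDo {b : Test} {P : Program} {T n : ℕ} {Inv : ℕ → State E → Prop}
    (hstep : ∀ k < n, ∀ σ, Inv k σ → b.Holds I.c σ ∧ Runs I stream s P σ T 0 (Inv (k + 1)))
    (hend : ∀ σ, Inv n σ → ¬ b.Holds I.c σ) {σ : State E} (h : Inv 0 σ) :
    Runs I stream s (.whileDo b P) σ (n * (T + 1) + 1) 0 (Inv n) := by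
  suffices H : ∀ j k, k + j = n → ∀ σ, Inv k σ →
      Runs I stream s (.whileDo b P) σ (j * (T + 1) + 1) 0 (Inv n) from H n 0 (by omega) σ h
  intro j
  induction j with
  | zero =>
    rintro k rfl σ h
    exact ⟨σ, 1, .whileFalse _ _ _ (hend σ h), by omega, h⟩
  | succ j ih =>
    intro k hk σ h
    obtain ⟨hb, σ', t, he, ht, h'⟩ := hstep k (by omega) σ h
    obtain ⟨σ'', t', he', ht', h''⟩ := ih (k + 1) (by omega) σ' h'
    refine ⟨σ'', _, .whileTrue _ _ _ _ _ _ _ _ _ hb he he', ?_, h''⟩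
    rw [Nat.succ_mul]
    omega

/-! ### Memory layout -/

/-- The memory holds the accuracy `ε`, the largest value `m` of a single item, the sets `A k` for
the guesses `k < M` with their sizes, and the best extension found so far: the item set `B` for the
guess `b`, with the value `V`. -/
structure Layout (I : KnapsackInstance E) (ε : ℝ) (M : ℕ) (m V : ℝ) (b : ℕ) (B : Finset E)
    (A : ℕ → Finset E) (σ : State E) : Prop where
  bounded : Bounded M I.K σ
  capacity : σ.nats 0 = I.K
  best : σ.nats 2 = b
  size : ∀ k < M, σ.nats (3 + k) = ∑ x ∈ A k, I.c x
  accuracy : σ.reals 0 = ε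
  maxValue : σ.reals 1 = m
  bestValue : σ.reals 6 = V
  output : σ.sets 0 = ∅
  bestItem : σ.sets 1 = B
  set : ∀ k < M, σ.sets (2 + k) = A k

section Layout

variable {ε m V : ℝ} {M b : ℕ} {B : Finset E} {A : ℕ → Finset E} {σ : State E}

lemma Layout.setRest (h : Layout I ε M m V b B A σ) (l : List E) :
    Layout I ε M m V b B A { σ with rest := l } :=
  ⟨h.bounded.setRest l, h.capacity, h.best, h.size, h.accuracy, h.maxValue, h.bestValue, h.output,
    h.bestItem, h.set⟩

lemma Layout.setGuess (h : Layout I ε M m V b B A σ) {v : ℕ} (hv : v ≤ M) :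
    Layout I ε M m V b B A (σ.setNatCell 1 v) where
  bounded := h.bounded.setNatCell (by omega) (by omega)
  capacity := by simpa [State.setNatCell] using h.capacity
  best := by simpa [State.setNatCell] using h.best
  size k hk := by
    have : 3 + k ≠ 1 := by omega
    simpa [State.setNatCell, this] using h.size k hk
  accuracy := h.accuracy
  maxValue := h.maxValue
  bestValue := h.bestValue
  output := h.output
  bestItem := h.bestItem
  set := h.set

/-- Real cells `2`, …, `5` hold the current guess and intermediate results. -/
lemma Layout.setReal (h : Layout I ε M m V b B A σ) {a : ℕ} (ha : 2 ≤ a) (ha' : a < 6) (v : ℝ) :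
    Layout I ε M m V b B A (σ.setRealCell a v) where
  bounded := h.bounded.setRealCell (by omega) v
  capacity := h.capacity
  best := h.best
  size := h.size
  accuracy := by
    have : 0 ≠ a := by omega
    simpa [State.setRealCell, this] using h.accuracy
  maxValue := by
    have : 1 ≠ a := by omega
    simpa [State.setRealCell, this] using h.maxValue
  bestValue := by
    have : 6 ≠ a := by omega
    simpa [State.setRealCell, this] using h.bestValue
  output := h.output
  bestItem := h.bestItem
  set := h.set

lemma Layout.setMaxValue (h : Layout I ε M m V b B A σ) (v : ℝ) :
    Layout I ε M v V b B A (σ.setRealCell 1 v) where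
  bounded := h.bounded.setRealCell (by omega) v
  capacity := h.capacity
  best := h.best
  size := h.size
  accuracy := by simpa [State.setRealCell] using h.accuracy
  maxValue := by simp [State.setRealCell]
  bestValue := by simpa [State.setRealCell] using h.bestValue
  output := h.output
  bestItem := h.bestItem
  set := h.set

lemma Layout.setBestValue (h : Layout I ε M m V b B A σ) (v : ℝ) :
    Layout I ε M m v b B A (σ.setRealCell 6 v) where
  bounded := h.bounded.setRealCell (by omega) v
  capacity := h.capacity
  best := h.best
  size := h.size
  accuracy := by simpa [State.setRealCell] using h.accuracy
  maxValue := by simpa [State.setRealCell] using h.maxValue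
  bestValue := by simp [State.setRealCell]
  output := h.output
  bestItem := h.bestItem
  set := h.set

lemma Layout.setBest (h : Layout I ε M m V b B A σ) {v : ℕ} (hv : v ≤ M) :
    Layout I ε M m V v B A (σ.setNatCell 2 v) where
  bounded := h.bounded.setNatCell (by omega) (by omega)
  capacity := by simpa [State.setNatCell] using h.capacity
  best := by simp [State.setNatCell]
  size k hk := by
    have : 3 + k ≠ 2 := by omega
    simpa [State.setNatCell, this] using h.size k hk
  accuracy := h.accuracy
  maxValue := h.maxValue
  bestValue := h.bestValue
  output := h.output
  bestItem := h.bestItem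
  set := h.set

lemma Layout.setBestItem (h : Layout I ε M m V b B A σ) {S : Finset E} (hS : S.card ≤ I.K) :
    Layout I ε M m V b S A (σ.setSetCell 1 S) where
  bounded := h.bounded.setSetCell (by omega) hS
  capacity := h.capacity
  best := h.best
  size := h.size
  accuracy := h.accuracy
  maxValue := h.maxValue
  bestValue := h.bestValue
  output := by simpa [State.setSetCell] using h.output
  bestItem := by simp [State.setSetCell]
  set k hk := by
    have : 2 + k ≠ 1 := by omega
    simpa [State.setSetCell, this] using h.set k hk

lemma Layout.setSet (h : Layout I ε M m V b B A σ) {k : ℕ} (hk : k < M) {S : Finset E}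
    (hS : I.Feasible S) :
    Layout I ε M m V b B (Function.update A k S)
      ((σ.setSetCell (2 + k) S).setNatCell (3 + k) (∑ x ∈ S, I.c x)) where
  bounded := by
    have hS' : ∑ x ∈ S, I.c x ≤ I.K := hS
    exact (h.bounded.setSetCell (by omega) (I.card_le_of_feasible hS)).setNatCell (by omega)
      (by omega)
  capacity := by
    have : 0 ≠ 3 + k := by omega
    simpa [State.setNatCell, State.setSetCell, this] using h.capacity
  best := by
    have : 2 ≠ 3 + k := by omega
    simpa [State.setNatCell, State.setSetCell, this] using h.best
  size j hj := by
    by_cases hjk : j = k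
    · simp [State.setNatCell, hjk]
    · simpa [State.setNatCell, State.setSetCell, hjk] using h.size j hj
  accuracy := h.accuracy
  maxValue := h.maxValue
  bestValue := h.bestValue
  output := by
    have : 0 ≠ 2 + k := by omega
    simpa [State.setNatCell, State.setSetCell, this] using h.output
  bestItem := by
    have : 1 ≠ 2 + k := by omega
    simpa [State.setNatCell, State.setSetCell, this] using h.bestItem
  set j hj := by
    by_cases hjk : j = k
    · simp [State.setNatCell, State.setSetCell, hjk]
    · simpa [State.setNatCell, State.setSetCell, hjk] using h.set j hj

lemma Layout.congr {A' : ℕ → Finset E} (h : Layout I ε M m V b B A σ)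
    (hA : ∀ k < M, A k = A' k) : Layout I ε M m V b B A' σ :=
  { h with
    size := fun k hk => hA k hk ▸ h.size k hk
    set := fun k hk => hA k hk ▸ h.set k hk }

end Layout

/-! ### Passes and loops over the guesses -/

/-- The instruction without effect that is used for empty branches. -/
def skip : Program := .instr (.setNat (.const 0) (.cell (.const 0)))

lemma runs_skip {σ : State E} (h : σ.Fits s) : Runs I stream s skip σ 1 0 (· = σ) :=
  Runs.step (by simp [Instr.step, State.setNatCell, NExp.eval]) h h le_rfl rfl

/-- One pass over the stream that runs `body` on each item. -/
def passOver (body : Program) : Program :=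
  .seq (.instr .beginPass) (.whileDo (.not .atEnd) (.seq body (.instr .advance)))

lemma runs_passOver {body : Program} {T : ℕ} {Inv : List E → State E → Prop}
    (hfits : ∀ d σ, Inv d σ → σ.Fits s)
    (hrest : ∀ d σ l, Inv d σ → Inv d { σ with rest := l })
    (hbody : ∀ d e l σ, stream = d ++ e :: l → Inv d σ → σ.rest = e :: l →
      Runs I stream s body σ T 0 fun σ' => Inv (d ++ [e]) σ' ∧ σ'.rest = e :: l)
    {σ : State E} (h : Inv [] σ) :
    Runs I stream s (passOver body) σ (stream.length * (T + 2) + 2) 1 (Inv stream) := by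
  have hloop : ∀ σ : State E, Inv [] σ → σ.rest = stream →
      Runs I stream s (.whileDo (.not .atEnd) (.seq body (.instr .advance))) σ
        (stream.length * (T + 2) + 1) 0 (Inv stream) := by
    intro σ h hσ
    obtain ⟨σ', t, he, ht, h'⟩ := Runs.whileDo (I := I) (stream := stream) (s := s)
      (b := .not .atEnd) (P := .seq body (.instr .advance)) (T := T + 1) (n := stream.length)
      (Inv := fun k σ => Inv (stream.take k) σ ∧ σ.rest = stream.drop k)
      (fun k hk σ hσ => by
        have hdrop := List.drop_eq_getElem_cons hk
        refine ⟨fun h : σ.rest = [] => absurd (hdrop ▸ hσ.2.symm.trans h) (List.cons_ne_nil _ _), ?_⟩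
        refine Runs.seq (hbody (stream.take k) stream[k] (stream.drop (k + 1)) σ
          (by rw [← hdrop, List.take_append_drop]) hσ.1 (hσ.2.trans hdrop)) (T' := 1) (p' := 0)
          (fun σ' h' => ?_) le_rfl
        refine Runs.instr (i := .advance) (hfits _ _ h'.1) (hfits _ _ (hrest _ _ _ h'.1)) le_rfl ?_
        refine ⟨?_, by simp [Instr.step, h'.2]⟩
        rw [← List.take_concat_get' _ _ hk]
        exact hrest _ _ _ h'.1)
      (fun σ hσ => by simp [Test.Holds, hσ.2]) (σ := σ) ⟨by simpa using h, by simpa using hσ⟩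
    exact ⟨σ', t, he, ht, by simpa using h'.1⟩
  exact Runs.seq (T := 1) (p := 1) (p' := 0)
    (Runs.instr (i := .beginPass) (Q := fun σ' => Inv [] σ' ∧ σ'.rest = stream)
      (hfits _ _ h) (hfits _ _ (hrest _ _ _ h)) le_rfl ⟨hrest _ _ _ h, rfl⟩)
    (fun σ' h' => hloop σ' h'.1 h'.2) (by omega)

/-- Run `body` for each guess. Guess number `k = i * N + j` has the size `w = r ^ i` in real
cell `2` and the factor `t = r ^ j` in real cell `3`, where `r = 1 + ε`, and `N` is the number of
powers of `r` that are at most the capacity. -/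
def forGuesses (body : Program) : Program :=
  .seq (.instr (.setNat (.const 1) (.const 0))) <|
  .seq (.instr (.setReal (.const 2) (.const 1))) <|
  .seq (.instr (.setReal (.const 3) (.const 1))) <|
  .whileDo (.not (.realLt (.ofNat (.cell (.const 0))) (.cell (.const 2)))) <|
  .seq body <|
  .seq (.instr (.setNat (.const 1) (.add (.cell (.const 1)) (.const 1)))) <|
  .seq (.instr (.setReal (.const 3)
    (.mul (.cell (.const 3)) (.add (.const 1) (.cell (.const 0)))))) <|
  .ite (.realLt (.ofNat (.cell (.const 0))) (.cell (.const 3)))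
    (.seq (.instr (.setReal (.const 3) (.const 1)))
      (.instr (.setReal (.const 2)
        (.mul (.cell (.const 2)) (.add (.const 1) (.cell (.const 0)))))))
    skip

/-- The cells that hold the current guess have the right content for guess number `k`. -/
def AtGuess (r : ℝ) (N k : ℕ) (σ : State E) : Prop :=
  σ.nats 1 = k ∧ σ.reals 2 = r ^ (k / N) ∧ σ.reals 3 = r ^ (k % N)

lemma runs_forGuesses {body : Program} {T N : ℕ} {ε : ℝ} {Inv : ℕ → State E → Prop} (hε : 0 < ε)
    (hN0 : 0 < N) (hN : (I.K : ℝ) < (1 + ε) ^ N) (hN' : ∀ i < N, (1 + ε) ^ i ≤ (I.K : ℝ))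
    (hcells : ∀ k σ, Inv k σ → σ.Fits s ∧ σ.nats 0 = I.K ∧ σ.reals 0 = ε)
    (hnat : ∀ k σ v, v ≤ N * N → Inv k σ → Inv k (σ.setNatCell 1 v))
    (hreal : ∀ k σ a v, a = 2 ∨ a = 3 → Inv k σ → Inv k (σ.setRealCell a v))
    (hbody : ∀ k < N * N, ∀ σ, Inv k σ → AtGuess (1 + ε) N k σ →
      Runs I stream s body σ T 0 fun σ' => Inv (k + 1) σ' ∧ AtGuess (1 + ε) N k σ')
    {σ : State E} (h : Inv 0 σ) :
    Runs I stream s (forGuesses body) σ (N * N * (T + 6) + 4) 0 (Inv (N * N)) := by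
  have hr : 1 < 1 + ε := by linarith
  have hn : ∀ {k σ} (v : ℕ), v ≤ N * N → Inv k σ → Inv k (σ.setNatCell 1 v) :=
    fun v hv h => hnat _ _ v hv h
  have h2 : ∀ {k σ} (v : ℝ), Inv k σ → Inv k (σ.setRealCell 2 v) :=
    fun v h => hreal _ _ 2 v (.inl rfl) h
  have h3 : ∀ {k σ} (v : ℝ), Inv k σ → Inv k (σ.setRealCell 3 v) :=
    fun v h => hreal _ _ 3 v (.inr rfl) h
  have hf : ∀ {k σ}, Inv k σ → σ.Fits s := fun h => (hcells _ _ h).1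
  have i1 := hn 0 (Nat.zero_le _) h
  have i2 := h2 1 i1
  have i3 := h3 1 i2
  refine Runs.seq_zero (Runs.step (σ' := σ.setNatCell 1 0) rfl (hf h) (hf i1) le_rfl rfl)
    (T' := N * N * (T + 6) + 3) ?_ (by omega)
  rintro _ rfl
  refine Runs.seq_zero (Runs.step (σ' := (σ.setNatCell 1 0).setRealCell 2 1)
    (by simp [Instr.step, RExp.eval, NExp.eval]) (hf i1) (hf i2) le_rfl rfl) (T' := N * N * (T + 6) + 2) ?_ (by omega)
  rintro _ rfl
  refine Runs.seq_zero (Runs.step (σ' := ((σ.setNatCell 1 0).setRealCell 2 1).setRealCell 3 1)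
    (by simp [Instr.step, RExp.eval, NExp.eval]) (hf i2) (hf i3) le_rfl rfl) (T' := N * N * (T + 6) + 1) ?_ (by omega)
  rintro _ rfl
  refine (Runs.whileDo (T := T + 5) (n := N * N)
    (Inv := fun k σ => Inv k σ ∧ AtGuess (1 + ε) N k σ) ?_ ?_ ⟨i3, ?_⟩).mono le_rfl fun _ h => h.1
  · rintro k hk σ ⟨h, hg⟩
    constructor
    · have := hN' (k / N) (Nat.div_lt_of_lt_mul hk)
      simpa [Test.Holds, RExp.eval, NExp.eval, (hcells k σ h).2.1, hg.2.1] using this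
    refine Runs.seq_zero (hbody k hk σ h hg) (T' := 5) ?_ le_rfl
    clear h hg σ
    rintro σ ⟨h, hg⟩
    obtain ⟨hfit, hK, hε'⟩ := hcells _ _ h
    have i1 := hn (k + 1) hk h
    have i2 := h3 ((1 + ε) ^ (k % N + 1)) i1
    refine Runs.seq_zero (Runs.step (σ' := σ.setNatCell 1 (k + 1))
      (by simp [Instr.step, NExp.eval, hg.1]) hfit (hf i1) le_rfl rfl) (T' := 4) ?_ le_rfl
    rintro _ rfl
    refine Runs.seq_zero (Runs.step
      (σ' := (σ.setNatCell 1 (k + 1)).setRealCell 3 ((1 + ε) ^ (k % N + 1)))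
      (by simp [Instr.step, NExp.eval, RExp.eval, State.setNatCell, hg.2.2, hε', pow_succ])
      (hf i1) (hf i2) le_rfl rfl) (T' := 3) ?_ le_rfl
    rintro _ rfl
    have hmod : k % N + 1 ≤ N := Nat.mod_lt k hN0
    refine Runs.ite (T := 2) ?_ ?_ le_rfl
    · intro hb
      replace hb : (I.K : ℝ) < (1 + ε) ^ (k % N + 1) := by
        simpa [Test.Holds, RExp.eval, NExp.eval, State.setRealCell, State.setNatCell, hK] using hb
      have hlast : k % N + 1 = N := by
        by_contra hne
        exact absurd (hN' _ (lt_of_le_of_ne hmod hne)) (not_le.2 hb)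
      have hk1 : k + 1 = N * (k / N + 1) := by
        rw [Nat.mul_succ, ← hlast, hlast]
        have := Nat.div_add_mod k N
        omega
      have hdiv : (k + 1) / N = k / N + 1 := by rw [hk1, Nat.mul_div_cancel_left _ hN0]
      have hmod' : (k + 1) % N = 0 := by rw [hk1, Nat.mul_mod_right]
      have i3 := h3 1 i2
      have i4 := h2 ((1 + ε) ^ (k / N + 1)) i3
      refine Runs.seq_zero (Runs.step (by simp [Instr.step, RExp.eval, NExp.eval]) (hf i2)
        (hf i3) le_rfl rfl) (T' := 1) ?_ le_rfl
      rintro _ rfl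
      refine (Runs.step
        (by simp [Instr.step, RExp.eval, NExp.eval, State.setRealCell, State.setNatCell, hg.2.1,
              hε', ← pow_succ]) (hf i3) (hf i4) le_rfl rfl).mono le_rfl ?_
      rintro _ rfl
      refine ⟨i4, ?_⟩
      simp [AtGuess, hdiv, hmod', State.setRealCell, State.setNatCell]
    · intro hb
      replace hb : (1 + ε) ^ (k % N + 1) ≤ (I.K : ℝ) := by
        simpa [Test.Holds, RExp.eval, NExp.eval, State.setRealCell, State.setNatCell, hK] using hb
      have hlt : k % N + 1 < N := by
        refine lt_of_le_of_ne hmod fun h => ?_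
        rw [h] at hb
        exact absurd hN (not_lt.2 hb)
      have hk1 : k + 1 = k % N + 1 + N * (k / N) := by
        have := Nat.div_add_mod k N
        omega
      have hdiv : (k + 1) / N = k / N := by
        rw [hk1, Nat.add_mul_div_left _ _ hN0, Nat.div_eq_of_lt hlt, zero_add]
      have hmod' : (k + 1) % N = k % N + 1 := by
        rw [hk1, Nat.add_mul_mod_self_left, Nat.mod_eq_of_lt hlt]
      refine (runs_skip (hf i2)).mono one_le_two ?_
      rintro _ rfl
      refine ⟨i2, ?_⟩
      simp [AtGuess, hdiv, hmod', State.setRealCell, State.setNatCell, hg.2.1]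
  · rintro σ ⟨h, hg⟩
    have : N * N / N = N := Nat.mul_div_cancel _ hN0
    simpa [Test.Holds, RExp.eval, NExp.eval, (hcells _ σ h).2.1, hg.2.1, this] using hN
  · simp [AtGuess, State.setRealCell, State.setNatCell]

end StreamRAM

/-! ### The streaming program -/

namespace StreamRAM

/-- The address of the set for the current guess. -/
def setAddr : NExp := .add (.const 2) (.cell (.const 1))

/-- The address of the size of the set for the current guess. -/
def sizeAddr : NExp := .add (.const 3) (.cell (.const 1))

/-- Update the largest value of a single item. Set cell `0` is empty at this stage. -/
def maxBody : Program :=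
  .seq (.instr (.queryCur (.const 4) (.const 0))) <|
  .ite (.realLt (.cell (.const 1)) (.cell (.const 4)))
    (.instr (.setReal (.const 1) (.cell (.const 4)))) skip

/-- One step of the threshold algorithm for the current guess. -/
def growBody : Program :=
  .seq (.instr (.query (.const 4) setAddr)) <|
  .seq (.instr (.queryCur (.const 5) setAddr)) <|
  .ite (.and (.realLt (.ofNat (.cell sizeAddr)) (.cell (.const 2))) <|
      .and (.not (.natLt (.cell (.const 0)) (.add (.cell sizeAddr) .curSize))) <|
      .not (.realLt
        (.mul (.mul (.const 2) (.cell (.const 2)))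
          (.sub (.cell (.const 5)) (.cell (.const 4))))
        (.mul (.mul (.cell (.const 1)) (.cell (.const 3))) (.ofNat .curSize))))
    (.seq (.instr (.insertCur setAddr))
      (.instr (.setNat sizeAddr (.add (.cell sizeAddr) .curSize))))
    skip

/-- Compare the best value found so far with the value of the set for the current guess, extended by
the current item if this fits into the knapsack. -/
def bestBody : Program :=
  .ite (.natLt (.cell (.const 0)) (.add (.cell sizeAddr) .curSize))
    (.seq (.instr (.query (.const 4) setAddr)) <|
      .ite (.realLt (.cell (.const 6)) (.cell (.const 4)))
        (.seq (.instr (.setReal (.const 6) (.cell (.const 4)))) <|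
          .seq (.instr (.setNat (.const 2) (.cell (.const 1)))) <|
          .instr (.clear (.const 1)))
        skip)
    (.seq (.instr (.queryCur (.const 4) setAddr)) <|
      .ite (.realLt (.cell (.const 6)) (.cell (.const 4)))
        (.seq (.instr (.setReal (.const 6) (.cell (.const 4)))) <|
          .seq (.instr (.setNat (.const 2) (.cell (.const 1)))) <|
          .seq (.instr (.clear (.const 1))) <|
          .instr (.insertCur (.const 1)))
        skip)

/-- Three passes that compute the largest value of an item, the greedy sets for all guesses, and the
best extension of one of these sets, which is then copied to the output. -/
def knapsackProgram : Program :=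
  .seq (passOver maxBody) <|
  .seq (passOver (forGuesses growBody)) <|
  .seq (passOver (forGuesses bestBody)) <|
  .seq (.instr (.union (.const 0) (.add (.const 2) (.cell (.const 2)))))
    (.instr (.union (.const 0) (.const 1)))

lemma State.cur_of_rest {E : Type*} {σ : State E} {e : E} {l : List E} (h : σ.rest = e :: l) :
    σ.cur = {e} := by
  simp [State.cur, h]

variable {E : Type*} [DecidableEq E] {I : KnapsackInstance E} {stream : List E}
  {ε m V r : ℝ} {M N b k : ℕ} {B : Finset E} {A : ℕ → Finset E} {σ : State E} {e : E} {l : List E}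

lemma Layout.fits (h : Layout I ε M m V b B A σ) (hM : 0 < M) : σ.Fits (8 * (M * I.K)) :=
  h.bounded.fits hM I.K_pos

lemma layout_init (I : KnapsackInstance E) (ε : ℝ) (M : ℕ) :
    Layout I ε M 0 0 0 ∅ (fun _ => ∅) (State.init I.K ε) where
  bounded :=
    { nats_le := fun i => by
        by_cases hi : i = 0 <;> simp [State.init, hi]
      nats_eq := fun i hi => by
        have : i ≠ 0 := by omega
        simp [State.init, this]
      reals_eq := fun i hi => by
        have : i ≠ 0 := by omega
        simp [State.init, this]
      card_le := fun i => by simp [State.init]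
      sets_eq := fun i _ => rfl }
  capacity := by simp [State.init]
  best := by simp [State.init]
  size k _ := by simp [State.init]
  accuracy := by simp [State.init]
  maxValue := by simp [State.init]
  bestValue := by simp [State.init]
  output := rfl
  bestItem := rfl
  set _ _ := rfl

lemma runs_maxBody (hM : 0 < M) (h : Layout I ε M m V b B A σ) (hσ : σ.rest = e :: l) :
    Runs I stream (8 * (M * I.K)) maxBody σ 3 0 fun σ' =>
      Layout I ε M (max m (I.f {e})) V b B A σ' ∧ σ'.rest = e :: l := by
  have i1 := h.setReal (a := 4) (by omega) (by omega) (I.f {e})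
  refine Runs.seq_zero (Runs.step (σ' := σ.setRealCell 4 (I.f {e}))
    (by simp [Instr.step, NExp.eval, h.output, State.cur_of_rest hσ])
    (h.fits hM) (i1.fits hM) le_rfl rfl) (T' := 2) ?_ le_rfl
  rintro _ rfl
  refine Runs.ite (T := 1) ?_ ?_ le_rfl
  · intro hb
    replace hb : m < I.f {e} := by
      simpa [Test.Holds, RExp.eval, NExp.eval, State.setRealCell, h.maxValue] using hb
    have i2 := i1.setMaxValue (I.f {e})
    refine (Runs.step (σ' := (σ.setRealCell 4 (I.f {e})).setRealCell 1 (I.f {e}))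
      (by simp [Instr.step, RExp.eval, NExp.eval, State.setRealCell])
      (i1.fits hM) (i2.fits hM) le_rfl rfl).mono le_rfl ?_
    rintro _ rfl
    rw [max_eq_right hb.le]
    exact ⟨i2, hσ⟩
  · intro hb
    replace hb : I.f {e} ≤ m := by
      simpa [Test.Holds, RExp.eval, NExp.eval, State.setRealCell, h.maxValue] using hb
    refine (runs_skip (i1.fits hM)).mono le_rfl ?_
    rintro _ rfl
    rw [max_eq_left hb]
    exact ⟨i1, hσ⟩

lemma runs_growBody (hM : 0 < M) (h : Layout I ε M m V b B A σ) (hσ : σ.rest = e :: l)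
    (hk : k < M) (hg : AtGuess r N k σ) (he : e ∉ A k) :
    Runs I stream (8 * (M * I.K)) growBody σ 5 0 fun σ' =>
      (Layout I ε M m V b B
        (Function.update A k (I.grow (m * r ^ (k % N)) (r ^ (k / N)) (A k) e)) σ' ∧
        σ'.rest = e :: l) ∧ AtGuess r N k σ' := by
  have i1 := h.setReal (a := 4) (by omega) (by omega) (I.f (A k))
  have i2 := i1.setReal (a := 5) (by omega) (by omega) (I.f (A k ∪ {e}))
  have hset := h.set k hk
  have hsize := h.size k hk
  have hcur := State.cur_of_rest hσ
  refine Runs.seq_zero (Runs.step (σ' := σ.setRealCell 4 (I.f (A k)))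
    (by simp [Instr.step, NExp.eval, setAddr, hg.1, hset])
    (h.fits hM) (i1.fits hM) le_rfl rfl) (T' := 4) ?_ le_rfl
  rintro _ rfl
  refine Runs.seq_zero (Runs.step
    (σ' := (σ.setRealCell 4 (I.f (A k))).setRealCell 5 (I.f (A k ∪ {e})))
    (by
      have hcur' : (σ.setRealCell 4 (I.f (A k))).cur = {e} := hcur
      simp [Instr.step, NExp.eval, setAddr, hcur']
      simp [State.setRealCell, hg.1, hset])
    (i1.fits hM) (i2.fits hM) le_rfl rfl) (T' := 3) ?_ le_rfl
  rintro _ rfl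
  have hcur2 : ((σ.setRealCell 4 (I.f (A k))).setRealCell 5 (I.f (A k ∪ {e}))).cur = {e} := hcur
  have htest : Test.Holds I.c ((σ.setRealCell 4 (I.f (A k))).setRealCell 5 (I.f (A k ∪ {e})))
      (.and (.realLt (.ofNat (.cell sizeAddr)) (.cell (.const 2))) <|
        .and (.not (.natLt (.cell (.const 0)) (.add (.cell sizeAddr) .curSize))) <|
        .not (.realLt
          (.mul (.mul (.const 2) (.cell (.const 2)))
            (.sub (.cell (.const 5)) (.cell (.const 4))))
          (.mul (.mul (.cell (.const 1)) (.cell (.const 3))) (.ofNat .curSize)))) ↔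
      I.Accepts (m * r ^ (k % N)) (r ^ (k / N)) (A k) e := by
    simp only [Test.Holds, RExp.eval, NExp.eval, hcur2, sizeAddr, Finset.sum_singleton]
    simp [State.setRealCell, hg.1, hg.2.1, hg.2.2, hsize, h.capacity, h.maxValue,
      KnapsackInstance.Accepts]
  refine Runs.ite (T := 2) ?_ ?_ le_rfl
  · intro hb
    replace hb := htest.1 hb
    have hfeas : I.Feasible (A k ∪ {e}) := by
      rw [KnapsackInstance.Feasible, KnapsackInstance.sum_union_singleton he]
      exact hb.2.1
    have i3 := i2.setSet hk hfeas
    rw [KnapsackInstance.grow_of_accepts hb]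
    generalize hτ : (σ.setRealCell 4 (I.f (A k))).setRealCell 5 (I.f (A k ∪ {e})) = τ at *
    have hτ1 : τ.nats 1 = k := by rw [← hτ]; exact hg.1
    have hfit : (τ.setSetCell (2 + k) (A k ∪ {e})).Fits (8 * (M * I.K)) :=
      (i2.bounded.setSetCell (by omega) (I.card_le_of_feasible hfeas)).fits hM I.K_pos
    refine Runs.seq_zero (Runs.step (σ' := τ.setSetCell (2 + k) (A k ∪ {e}))
      (by simp [Instr.step, NExp.eval, setAddr, hτ1, hcur2, i2.set k hk])
      (i2.fits hM) hfit le_rfl rfl) (T' := 1) ?_ le_rfl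
    rintro _ rfl
    refine (Runs.step (σ' := (τ.setSetCell (2 + k) (A k ∪ {e})).setNatCell (3 + k)
        (∑ x ∈ A k ∪ {e}, I.c x))
      (by
        have hcur3 : (τ.setSetCell (2 + k) (A k ∪ {e})).cur = {e} := hcur2
        simp only [Instr.step, NExp.eval, sizeAddr, hcur3, Finset.sum_singleton,
          KnapsackInstance.sum_union_singleton he]
        simp [State.setSetCell, hτ1, i2.size k hk])
      hfit (i3.fits hM) le_rfl rfl).mono le_rfl ?_
    rintro _ rfl
    refine ⟨⟨i3, by subst hτ; exact hσ⟩, ?_⟩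
    have : 1 ≠ 3 + k := by omega
    subst hτ
    simpa [AtGuess, State.setNatCell, State.setSetCell, State.setRealCell, this] using hg
  · intro hb
    rw [KnapsackInstance.grow_of_not_accepts fun h => hb (htest.2 h), Function.update_eq_self]
    refine (runs_skip (i2.fits hM)).mono one_le_two ?_
    rintro _ rfl
    exact ⟨⟨i2, hσ⟩, by simpa [AtGuess, State.setRealCell] using hg⟩

/-- The value of `S`, extended by `e` if this fits into the knapsack. -/
noncomputable def extensionValue (I : KnapsackInstance E) (S : Finset E) (e : E) : ℝ :=
  if ∑ x ∈ S, I.c x + I.c e ≤ I.K then I.f (S ∪ {e}) else I.f S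

/-- The layout with a feasible best extension whose value is at least the recorded value `V`. -/
def HasBest (I : KnapsackInstance E) (ε : ℝ) (M : ℕ) (m V : ℝ) (A : ℕ → Finset E) (σ : State E) :
    Prop :=
  ∃ b B, Layout I ε M m V b B A σ ∧ b < M ∧ V ≤ I.f (A b ∪ B) ∧ I.Feasible (A b ∪ B)

lemma runs_bestBody (hM : 0 < M) (h : HasBest I ε M m V A σ) (hσ : σ.rest = e :: l)
    (hk : k < M) (hg : AtGuess r N k σ) (hA : I.Feasible (A k)) :
    Runs I stream (8 * (M * I.K)) bestBody σ 7 0 fun σ' =>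
      (HasBest I ε M m (max V (extensionValue I (A k) e)) A σ' ∧ σ'.rest = e :: l) ∧
        AtGuess r N k σ' := by
  obtain ⟨b, B, h, hb, hV, hB⟩ := h
  have hset := h.set k hk
  have hsize := h.size k hk
  have hcur := State.cur_of_rest hσ
  have htest : Test.Holds I.c σ (.natLt (.cell (.const 0)) (.add (.cell sizeAddr) .curSize)) ↔
      ¬ ∑ x ∈ A k, I.c x + I.c e ≤ I.K := by
    simp [Test.Holds, NExp.eval, sizeAddr, hcur, hg.1, hsize, h.capacity]
  have key : ∀ v, v = extensionValue I (A k) e → v ≤ V → Runs I stream (8 * (M * I.K)) skip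
      (σ.setRealCell 4 v) 4 0 fun σ' =>
      (HasBest I ε M m (max V (extensionValue I (A k) e)) A σ' ∧ σ'.rest = e :: l) ∧
        AtGuess r N k σ' := by
    rintro v hv hle
    have i1 := h.setReal (a := 4) (by omega) (by omega) v
    refine (runs_skip (i1.fits hM)).mono (by omega) ?_
    rintro _ rfl
    rw [← hv, max_eq_left hle]
    exact ⟨⟨⟨b, B, i1, hb, hV, hB⟩, hσ⟩, by simpa [AtGuess, State.setRealCell] using hg⟩
  refine Runs.ite (T := 6) ?_ ?_ le_rfl
  · intro hbig
    replace hbig := htest.1 hbig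
    have hv : I.f (A k) = extensionValue I (A k) e := (if_neg hbig).symm
    have i1 := h.setReal (a := 4) (by omega) (by omega) (I.f (A k))
    have i2 := i1.setBestValue (I.f (A k))
    have i3 := i2.setBest hk.le
    have i4 := i3.setBestItem (S := ∅) (by simp)
    refine Runs.seq_zero (Runs.step (σ' := σ.setRealCell 4 (I.f (A k)))
      (by simp [Instr.step, NExp.eval, setAddr, hg.1, hset])
      (h.fits hM) (i1.fits hM) le_rfl rfl) (T' := 5) ?_ le_rfl
    rintro _ rfl
    refine Runs.ite (T := 4) ?_ ?_ le_rfl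
    · intro hlt
      replace hlt : V < I.f (A k) := by
        simpa [Test.Holds, RExp.eval, NExp.eval, State.setRealCell, h.bestValue] using hlt
      refine Runs.seq_zero (Runs.step (by simp [Instr.step, RExp.eval, NExp.eval]; rfl)
        (i1.fits hM) (σ' := (σ.setRealCell 4 (I.f (A k))).setRealCell 6 (I.f (A k))) (i2.fits hM)
        le_rfl rfl) (T' := 2) ?_ (by omega)
      rintro _ rfl
      refine Runs.seq_zero (Runs.step (by simp [Instr.step, NExp.eval, State.setRealCell, hg.1])
        (i2.fits hM) (i3.fits hM) le_rfl rfl) (T' := 1) ?_ (by omega)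
      rintro _ rfl
      refine (Runs.step (by simp [Instr.step, NExp.eval]) (i3.fits hM) (i4.fits hM) le_rfl
        rfl).mono le_rfl ?_
      rintro _ rfl
      rw [← hv, max_eq_right hlt.le]
      exact ⟨⟨⟨k, ∅, i4, hk, by simp, by simpa using hA⟩, hσ⟩,
        by simpa [AtGuess, State.setRealCell, State.setNatCell, State.setSetCell] using hg⟩
    · intro hle
      replace hle : I.f (A k) ≤ V := by
        simpa [Test.Holds, RExp.eval, NExp.eval, State.setRealCell, h.bestValue] using hle
      exact key _ hv hle
  · intro hfit
    replace hfit := not_not.1 fun h => hfit (htest.2 h)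
    have hv : I.f (A k ∪ {e}) = extensionValue I (A k) e := (if_pos hfit).symm
    have hfeas : I.Feasible (A k ∪ {e}) := by
      refine le_trans ?_ hfit
      rw [← Finset.sum_singleton I.c e, ← Finset.sum_union_inter]
      exact Nat.le_add_right _ _
    have i1 := h.setReal (a := 4) (by omega) (by omega) (I.f (A k ∪ {e}))
    have i2 := i1.setBestValue (I.f (A k ∪ {e}))
    have i3 := i2.setBest hk.le
    have i4 := i3.setBestItem (S := ∅) (by simp)
    have i5 := i4.setBestItem (S := {e}) (by simpa [Nat.succ_le_iff] using I.K_pos)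
    refine Runs.seq_zero (Runs.step (σ' := σ.setRealCell 4 (I.f (A k ∪ {e})))
      (by simp [Instr.step, NExp.eval, setAddr, hg.1, hset, hcur])
      (h.fits hM) (i1.fits hM) le_rfl rfl) (T' := 5) ?_ le_rfl
    rintro _ rfl
    refine Runs.ite (T := 4) ?_ ?_ le_rfl
    · intro hlt
      replace hlt : V < I.f (A k ∪ {e}) := by
        simpa [Test.Holds, RExp.eval, NExp.eval, State.setRealCell, h.bestValue] using hlt
      refine Runs.seq_zero (Runs.step (by simp [Instr.step, RExp.eval, NExp.eval]; rfl)
        (i1.fits hM) (σ' := (σ.setRealCell 4 (I.f (A k ∪ {e}))).setRealCell 6 (I.f (A k ∪ {e})))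
        (i2.fits hM) le_rfl rfl) (T' := 3) ?_ (by omega)
      rintro _ rfl
      refine Runs.seq_zero (Runs.step (by simp [Instr.step, NExp.eval, State.setRealCell, hg.1])
        (i2.fits hM) (i3.fits hM) le_rfl rfl) (T' := 2) ?_ (by omega)
      rintro _ rfl
      refine Runs.seq_zero (Runs.step (by simp [Instr.step, NExp.eval]) (i3.fits hM) (i4.fits hM)
        le_rfl rfl) (T' := 1) ?_ (by omega)
      rintro _ rfl
      refine (Runs.step ?_ (i4.fits hM) (i5.fits hM) le_rfl rfl).mono le_rfl ?_
      · have hcur' : ((((σ.setRealCell 4 (I.f (A k ∪ {e}))).setRealCell 6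
            (I.f (A k ∪ {e}))).setNatCell 2 k).setSetCell 1 ∅).cur = {e} := hcur
        simp only [Instr.step, NExp.eval, hcur', i4.bestItem, Finset.empty_union]
      rintro _ rfl
      rw [← hv, max_eq_right hlt.le]
      exact ⟨⟨⟨k, {e}, i5, hk, le_rfl, hfeas⟩, hσ⟩,
        by simpa [AtGuess, State.setRealCell, State.setNatCell, State.setSetCell] using hg⟩
    · intro hle
      replace hle : I.f (A k ∪ {e}) ≤ V := by
        simpa [Test.Holds, RExp.eval, NExp.eval, State.setRealCell, h.bestValue] using hle
      exact key _ hv hle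

end StreamRAM

/-! ### The three passes -/

namespace StreamRAM

variable {E : Type*} [DecidableEq E] {I : KnapsackInstance E} {stream : List E} {ε m : ℝ}
  {M N : ℕ} {σ : State E}

/-- The greedy set for guess number `k`, for the maximal value `m` of an item. -/
noncomputable def guessSet (I : KnapsackInstance E) (ε m : ℝ) (N k : ℕ) (l : List E) : Finset E :=
  I.greedy (m * (1 + ε) ^ (k % N)) ((1 + ε) ^ (k / N)) l

lemma runs_maxPass (hM : 0 < M) {v : ℝ} (hv0 : 0 ≤ v) (hv : ∀ e, I.f {e} ≤ v)
    (h : Layout I ε M 0 0 0 ∅ (fun _ => ∅) σ) :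
    Runs I stream (8 * (M * I.K)) (passOver maxBody) σ (stream.length * 5 + 2) 1 fun σ' =>
      ∃ m, Layout I ε M m 0 0 ∅ (fun _ => ∅) σ' ∧ 0 ≤ m ∧ m ≤ v ∧ ∀ e ∈ stream, I.f {e} ≤ m := by
  refine runs_passOver (T := 3) (Inv := fun d σ' => ∃ m, Layout I ε M m 0 0 ∅ (fun _ => ∅) σ' ∧
    0 ≤ m ∧ m ≤ v ∧ ∀ e ∈ d, I.f {e} ≤ m) ?_ ?_ ?_ ⟨0, h, le_rfl, hv0, by simp⟩
  · rintro d σ ⟨m, h, -⟩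
    exact h.fits hM
  · rintro d σ l ⟨m, h, h'⟩
    exact ⟨m, h.setRest l, h'⟩
  · rintro d e l σ - ⟨m, h, h0, hmv, hd⟩ hσ
    refine (runs_maxBody hM h hσ).mono le_rfl ?_
    rintro σ' ⟨h', hσ'⟩
    refine ⟨⟨_, h', le_max_of_le_left h0, max_le hmv (hv e), fun x hx => ?_⟩, hσ'⟩
    rcases List.mem_append.1 hx with hx | hx
    · exact le_max_of_le_left (hd x hx)
    · rw [List.mem_singleton.1 hx]
      exact le_max_right _ _

lemma runs_growPass (hε : 0 < ε) (hN0 : 0 < N) (hN : (I.K : ℝ) < (1 + ε) ^ N)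
    (hN' : ∀ i < N, (1 + ε) ^ i ≤ (I.K : ℝ)) (hs : stream.Nodup)
    (h : Layout I ε (N * N) m 0 0 ∅ (fun _ => ∅) σ) :
    Runs I stream (8 * (N * N * I.K)) (passOver (forGuesses growBody)) σ
      (stream.length * (N * N * 11 + 6) + 2) 1 fun σ' =>
      Layout I ε (N * N) m 0 0 ∅ (fun k => guessSet I ε m N k stream) σ' := by
  have hM : 0 < N * N := Nat.mul_pos hN0 hN0
  refine runs_passOver (T := N * N * 11 + 4)
    (Inv := fun d σ' => Layout I ε (N * N) m 0 0 ∅ (fun k => guessSet I ε m N k d) σ')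
    (fun d σ h => h.fits hM) (fun d σ l h => h.setRest l) ?_ h
  intro d e l σ hstream h hσ
  rw [hstream] at hs
  have hd : d.Nodup := (List.nodup_append.1 hs).1
  have he : e ∉ d := fun h => (List.nodup_append.1 hs).2.2 e h e (by simp) rfl
  have hloop := runs_forGuesses (I := I) (stream := stream) (s := 8 * (N * N * I.K))
    (body := growBody) (T := 5) (σ := σ)
    (Inv := fun k σ' => Layout I ε (N * N) m 0 0 ∅
      (fun j => guessSet I ε m N j (if j < k then d ++ [e] else d)) σ' ∧ σ'.rest = e :: l)
    hε hN0 hN hN' (fun k σ h => ⟨h.1.fits hM, h.1.capacity, h.1.accuracy⟩)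
    (fun k σ v hv h => ⟨h.1.setGuess hv, h.2⟩)
    (fun k σ a v ha h => ⟨h.1.setReal (by omega) (by omega) v, h.2⟩) ?_ ⟨by simpa using h, hσ⟩
  · refine hloop.mono le_rfl fun σ' h' => ⟨h'.1.congr fun k hk => by simp [hk], h'.2⟩
  · rintro k hk σ ⟨h, hσ⟩ hg
    refine (runs_growBody hM h hσ hk hg ?_).mono le_rfl ?_
    · simpa [guessSet] using fun hmem => he (KnapsackInstance.mem_of_mem_greedy hmem)
    rintro σ' ⟨⟨h', hσ'⟩, hg'⟩
    refine ⟨⟨h'.congr fun j hj => ?_, hσ'⟩, hg'⟩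
    by_cases hjk : j = k
    · subst hjk
      simp [guessSet, KnapsackInstance.greedy_concat]
    · have : j < k + 1 ↔ j < k := by omega
      simp [hjk, this]

lemma runs_bestPass (hε : 0 < ε) (hN0 : 0 < N) (hN : (I.K : ℝ) < (1 + ε) ^ N)
    (hN' : ∀ i < N, (1 + ε) ^ i ≤ (I.K : ℝ)) {A : ℕ → Finset E} (hA : ∀ k, I.Feasible (A k))
    (h : Layout I ε (N * N) m 0 0 ∅ A σ) :
    Runs I stream (8 * (N * N * I.K)) (passOver (forGuesses bestBody)) σ
      (stream.length * (N * N * 13 + 6) + 2) 1 fun σ' =>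
      ∃ V, HasBest I ε (N * N) m V A σ' ∧
        ∀ x ∈ stream, ∀ k < N * N, extensionValue I (A k) x ≤ V := by
  have hM : 0 < N * N := Nat.mul_pos hN0 hN0
  refine runs_passOver (T := N * N * 13 + 4)
    (Inv := fun d σ' => ∃ V, HasBest I ε (N * N) m V A σ' ∧
        ∀ x ∈ d, ∀ k < N * N, extensionValue I (A k) x ≤ V) ?_ ?_ ?_
    ⟨0, ⟨0, ∅, h, hM, I.f_nonneg _, by simpa using hA 0⟩, by simp⟩
  · rintro d σ ⟨V, ⟨b, B, h, -⟩, -⟩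
    exact h.fits hM
  · rintro d σ l ⟨V, ⟨b, B, h, h'⟩, h''⟩
    exact ⟨V, ⟨b, B, h.setRest l, h'⟩, h''⟩
  rintro d e l σ - ⟨V, h, hd⟩ hσ
  have hloop := runs_forGuesses (I := I) (stream := stream) (s := 8 * (N * N * I.K))
    (body := bestBody) (T := 7) (σ := σ)
    (Inv := fun k σ' => ∃ V, HasBest I ε (N * N) m V A σ' ∧ σ'.rest = e :: l ∧
      (∀ x ∈ d, ∀ k < N * N, extensionValue I (A k) x ≤ V) ∧
      ∀ j < k, extensionValue I (A j) e ≤ V)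
    hε hN0 hN hN' ?_ ?_ ?_ ?_ ⟨V, h, hσ, hd, by simp⟩
  · refine hloop.mono le_rfl ?_
    rintro σ' ⟨V', h', hσ', hd', he'⟩
    refine ⟨⟨V', h', fun x hx => ?_⟩, hσ'⟩
    rcases List.mem_append.1 hx with hx | hx
    · exact hd' x hx
    · rw [List.mem_singleton.1 hx]
      exact he'
  · rintro k σ ⟨V, ⟨b, B, h, -⟩, -⟩
    exact ⟨h.fits hM, h.capacity, h.accuracy⟩
  · rintro k σ v hv ⟨V, ⟨b, B, h, h'⟩, h''⟩
    exact ⟨V, ⟨b, B, h.setGuess hv, h'⟩, h''⟩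
  · rintro k σ a v ha ⟨V, ⟨b, B, h, h'⟩, h''⟩
    exact ⟨V, ⟨b, B, h.setReal (by omega) (by omega) v, h'⟩, h''⟩
  · rintro k hk σ ⟨V, h, hσ, hd, he⟩ hg
    refine (runs_bestBody hM h hσ hk hg (hA k)).mono le_rfl ?_
    rintro σ' ⟨⟨h', hσ'⟩, hg'⟩
    refine ⟨⟨_, h', hσ', fun x hx j hj => le_max_of_le_left (hd x hx j hj), fun j hj => ?_⟩, hg'⟩
    rcases Nat.lt_succ_iff_lt_or_eq.1 hj with hj | rfl
    · exact le_max_of_le_left (he j hj)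
    · exact le_max_right _ _

lemma runs_output [Fintype E] (hM : 0 < M) {V : ℝ} {A : ℕ → Finset E}
    (h : HasBest I ε M m V A σ) :
    Runs I stream (8 * (M * I.K))
      (.seq (.instr (.union (.const 0) (.add (.const 2) (.cell (.const 2)))))
        (.instr (.union (.const 0) (.const 1)))) σ (2 * Fintype.card E + 2) 0 fun σ' =>
      I.Feasible (σ'.sets 0) ∧ V ≤ I.f (σ'.sets 0) := by
  obtain ⟨b, B, h, hb, hV, hB⟩ := h
  have hAb : I.Feasible (A b) :=
    (Finset.sum_le_sum_of_subset Finset.subset_union_left).trans hB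
  have h1 := h.bounded.setSetCell (a := 0) (by omega) (I.card_le_of_feasible hAb)
  have h2 := h1.setSetCell (a := 0) (by omega) (I.card_le_of_feasible hB)
  have e1 : Instr.step I stream σ (.union (.const 0) (.add (.const 2) (.cell (.const 2)))) =
      σ.setSetCell 0 (A b) := by
    simp [Instr.step, NExp.eval, h.best, h.output, h.set b hb]
  have e2 : Instr.step I stream (σ.setSetCell 0 (A b)) (.union (.const 0) (.const 1)) =
      (σ.setSetCell 0 (A b)).setSetCell 0 (A b ∪ B) := by
    simp [Instr.step, NExp.eval, State.setSetCell, h.bestItem]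
  refine Runs.seq (p := 0) (p' := 0) (T := Fintype.card E + 1) (T' := Fintype.card E + 1)
    (Q := (· = σ.setSetCell 0 (A b)))
    (Runs.instr (i := .union (.const 0) (.add (.const 2) (.cell (.const 2))))
      (h.fits hM) (by rw [e1]; exact h1.fits hM I.K_pos) ?_ e1) ?_ (by omega)
  · have := Finset.card_le_univ (σ.sets (2 + σ.nats 2))
    simp only [Instr.time, NExp.eval]
    omega
  rintro _ rfl
  refine Runs.instr (i := .union (.const 0) (.const 1)) (h1.fits hM I.K_pos)
    (by rw [e2]; exact h2.fits hM I.K_pos) ?_ ?_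
  · have := Finset.card_le_univ ((σ.setSetCell 0 (A b)).sets 1)
    simp only [Instr.time, NExp.eval]
    omega
  · rw [e2]
    simpa [State.setSetCell] using ⟨hB, hV⟩

/-! ### The approximation guarantee of the program -/

/-- One of the guesses is good enough for the guarantee of the threshold algorithm. -/
lemma exists_guess (hε : 0 < ε) (hN : (I.K : ℝ) < (1 + ε) ^ N) (hs : stream.Nodup)
    (hmem : ∀ e, e ∈ stream) {O : Finset E} (hO : I.Feasible O) {o : E} (ho : o ∈ O)
    (hbig : I.K ≤ 2 * I.c o) (hm0 : 0 ≤ m) (hmO : m ≤ I.f O) (hm : ∀ e, I.f {e} ≤ m) :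
    ∃ k < N * N, (1 / 2 - ε) * I.f O ≤ extensionValue I (guessSet I ε m N k stream) o := by
  have hr : 1 < 1 + ε := by linarith
  have hK1 : (1 : ℝ) ≤ I.K := by exact_mod_cast I.K_pos
  have hOm : I.f O ≤ I.K * m := (I.f_le_card_mul ⟨o, ho⟩ hm).trans
    (mul_le_mul_of_nonneg_right (by exact_mod_cast I.card_le_of_feasible hO) hm0)
  obtain ⟨j, hj, hj1, hj2⟩ : ∃ j < N, m * (1 + ε) ^ j ≤ I.f O ∧
      I.f O ≤ (1 + ε) * (m * (1 + ε) ^ j) := by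
    rcases hm0.eq_or_lt with rfl | hpos
    · obtain ⟨j, hj, -⟩ := KnapsackInstance.exists_pow_grid hr hN le_rfl hK1
      exact ⟨j, hj, by simpa using I.f_nonneg O, by simpa using hOm⟩
    · obtain ⟨j, hj, h1, h2⟩ := KnapsackInstance.exists_pow_grid hr hN ((one_le_div hpos).2 hmO)
        ((div_le_iff₀ hpos).2 hOm)
      rw [le_div_iff₀ hpos] at h1
      rw [div_le_iff₀ hpos] at h2
      exact ⟨j, hj, by linarith, by linarith⟩
  obtain ⟨i, hi, hi1, hi2⟩ := KnapsackInstance.exists_pow_grid hr hN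
    (le_max_left 1 ((I.K - I.c o : ℕ) : ℝ)) (max_le hK1 (by exact_mod_cast Nat.sub_le _ _))
  have hk : N * i + j < N * N := by
    calc N * i + j < N * i + N := by omega
      _ = N * (i + 1) := by ring
      _ ≤ N * N := Nat.mul_le_mul_left N hi
  have hdiv : (N * i + j) / N = i := by
    rw [Nat.mul_add_div (by omega), Nat.div_eq_of_lt hj, add_zero]
  have hmod : (N * i + j) % N = j := by rw [Nat.mul_add_mod, Nat.mod_eq_of_lt hj]
  refine ⟨N * i + j, hk, ?_⟩
  rw [guessSet, hdiv, hmod, extensionValue]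
  rcases KnapsackInstance.greedy_guarantee (p := m * (1 + ε) ^ j) (w := (1 + ε) ^ i) hε hs hmem hO
    ho hbig (by positivity) (by positivity) hj1 hj2 hi1 ((le_max_right _ _).trans hi2) with h | h
  · refine h.trans ?_
    split_ifs
    · exact I.f_monotone _ _ Finset.subset_union_left
    · exact le_rfl
  · rw [if_pos h.1]
    exact h.2

lemma runs_knapsackProgram [Fintype E] (hε : 0 < ε) (hN0 : 0 < N)
    (hN : (I.K : ℝ) < (1 + ε) ^ N) (hN' : ∀ i < N, (1 + ε) ^ i ≤ (I.K : ℝ)) (hs : stream.Nodup)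
    (hmem : ∀ e, e ∈ stream) {O : Finset E} (hO : I.IsOptimal O) {o : E} (ho : o ∈ O)
    (hbig : I.K ≤ 2 * I.c o) :
    Runs I stream (8 * (N * N * I.K)) knapsackProgram (State.init I.K ε)
      (60 * (Fintype.card E * (N * N))) 3 fun σ =>
      I.Feasible (σ.sets 0) ∧ (1 / 2 - ε) * I.f O ≤ I.f (σ.sets 0) := by
  have hM : 0 < N * N := Nat.mul_pos hN0 hN0
  have hlen : stream.length = Fintype.card E := by
    have huniv : stream.toFinset = Finset.univ := by ext e; simp [hmem e]
    rw [← List.toFinset_card_of_nodup hs, huniv, Finset.card_univ]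
  have hn : 0 < Fintype.card E := Fintype.card_pos_iff.2 ⟨o⟩
  have hnM : Fintype.card E ≤ Fintype.card E * (N * N) := Nat.le_mul_of_pos_right _ hM
  refine Runs.seq (p := 1) (p' := 2) (T' := Fintype.card E * (N * N * 24 + 14) + 6)
    (runs_maxPass hM (I.f_nonneg O) (fun e => hO.2 _ (I.feasible_singleton e))
      (layout_init I ε (N * N))) ?_ (by rw [hlen, Nat.mul_add, ← Nat.mul_assoc _ (N * N)]; omega)
  rintro σ₁ ⟨m, h1, hm0, hmO, hm⟩
  refine Runs.seq (p := 1) (p' := 1) (T' := Fintype.card E * (N * N * 13 + 8) + 4)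
    (runs_growPass hε hN0 hN hN' hs h1) ?_
    (by rw [hlen]; simp only [Nat.mul_add, ← Nat.mul_assoc _ (N * N)]; omega)
  intro σ₂ h2
  refine Runs.seq (p := 1) (p' := 0) (T' := 2 * Fintype.card E + 2)
    (runs_bestPass hε hN0 hN hN' (fun k => KnapsackInstance.feasible_greedy hs) h2) ?_
    (by rw [hlen]; simp only [Nat.mul_add, ← Nat.mul_assoc _ (N * N)]; omega)
  rintro σ₃ ⟨V, h3, hV⟩
  refine (runs_output hM h3).mono le_rfl ?_
  rintro σ₄ ⟨hfeas, hV'⟩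
  obtain ⟨k, hk, hval⟩ := exists_guess hε hN hs hmem hO.1 ho hbig hm0 hmO (fun e => hm e (hmem e))
  exact ⟨hfeas, hval.trans ((hV o (hmem o) k hk).trans hV')⟩

end StreamRAM

theorem mainTheorem6 :
    ∃ (P : StreamRAM.Program) (C : ℝ), 0 < C ∧
      ∀ (ε : ℝ), 0 < ε → ε < 1 →
      ∀ (E : Type*) [Fintype E] [DecidableEq E] (I : KnapsackInstance E)
        (stream : List E), stream.Nodup → (∀ e, e ∈ stream) →
      ∀ (OPT : Finset E), I.IsOptimal OPT →
      ∀ o₁ ∈ OPT, (∀ e ∈ OPT, I.c e ≤ I.c o₁) → (1 / 2 : ℝ) ≤ (I.c o₁ : ℝ) / (I.K : ℝ) →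
      ∃ (σ : StreamRAM.State E) (time passes space : ℕ),
        StreamRAM.Exec I stream space P (StreamRAM.State.init I.K ε) σ time passes ∧
        I.Feasible (σ.sets 0) ∧
        (1 / 2 - ε) * I.f OPT ≤ I.f (σ.sets 0) ∧
        (passes : ℝ) ≤ C * ε⁻¹ ∧
        (space : ℝ) ≤ C * ((I.K : ℝ) * (ε⁻¹) ^ 5 * Real.log ((I.K : ℝ) + 1) ^ 2) ∧
        (time : ℝ) ≤ C * ((Fintype.card E : ℝ) * (ε⁻¹) ^ 6 * Real.log ((I.K : ℝ) + 1) ^ 2) := by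
  refine ⟨StreamRAM.knapsackProgram, 960, by norm_num, ?_⟩
  intro ε hε hε1 E _ _ I stream hs hmem OPT hOPT o₁ ho _ hhalf
  obtain ⟨N, hN0, hN, hN', hNle⟩ := KnapsackInstance.exists_grid_size hε hε1 I.K_pos
  have hKpos : (0 : ℝ) < I.K := by exact_mod_cast I.K_pos
  have hbig : I.K ≤ 2 * I.c o₁ := by
    rw [le_div_iff₀ hKpos] at hhalf
    have : (I.K : ℝ) ≤ 2 * I.c o₁ := by linarith
    exact_mod_cast this
  obtain ⟨σ, t, hexec, ht, hfeas, hval⟩ :=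
    StreamRAM.runs_knapsackProgram hε hN0 hN hN' hs hmem hOPT ho hbig
  have hinv : 1 ≤ ε⁻¹ := (one_le_inv₀ hε).2 hε1.le
  set L := Real.log ((I.K : ℝ) + 1)
  have hNN : (N : ℝ) * N ≤ 16 * ((ε⁻¹) ^ 2 * L ^ 2) := by
    calc (N : ℝ) * N ≤ 4 * (ε⁻¹ * L) * (4 * (ε⁻¹ * L)) :=
          mul_self_le_mul_self (Nat.cast_nonneg N) hNle
      _ = 16 * ((ε⁻¹) ^ 2 * L ^ 2) := by ring
  have hpow : ∀ a, 2 ≤ a → (N : ℝ) * N ≤ 16 * ((ε⁻¹) ^ a * L ^ 2) := fun a ha =>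
    hNN.trans (by gcongr)
  refine ⟨σ, t, 3, _, hexec, hfeas, hval, ?_, ?_, ?_⟩
  · push_cast
    linarith
  · have h := mul_le_mul_of_nonneg_left (hpow 5 (by norm_num)) hKpos.le
    have h0 : 0 ≤ (I.K : ℝ) * (ε⁻¹) ^ 5 * L ^ 2 := by positivity
    push_cast
    linarith
  · have h := mul_le_mul_of_nonneg_left (hpow 6 (by norm_num)) (Nat.cast_nonneg (Fintype.card E) :
      (0 : ℝ) ≤ Fintype.card E)
    have ht' : (t : ℝ) ≤ 60 * (Fintype.card E * (N * N)) := by exact_mod_cast ht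
    linarith
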